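/- For $n\ge 0$ call a word $b_0b_1\cdots b_{m-1}$ over $\{0,1\}$ a reversed binary representation of $n$ if $n=\sum_{k<m} b_k2^k$ (trailing zeros are allowed), and let $(n)_2$ be the one without trailing zeros (empty for $n=0$). The regular paperfolding sequence $\mathbf p=p(0)p(1)p(2)\cdots$ is defined as follows: writing $(n)_2\,00$ as $1^i\,0\,a\,w$ with $i\ge 0$, $a\in\{0,1\}$, $w\in\{0,1\}^*$, put $p(n)=(-1)^a$. A factor of length $n$ of $\mathbf p$ is a word $p(j)p(j+1)\cdots p(j+n-1)$ with $j\ge 0$. A word $v$ is bordered if it begins and ends with the same word $x$ for some $x$ with $0<|x|\le |v|/2$, and unbordered otherwise. Let $A$ be the deterministic automaton over $\{0,1\}$ with states $0,1,\dots,16$, initial state $0$, only accepting state $11$, and the following transitions, where $q:(r,s)$ means that $q$ goes to $r$ on the digit $0$ and to $s$ on the digit $1$: $$\begin{array}{llllll} 0:(1,2)& 1:(3,4)& 2:(5,3)& 3:(3,3)& 4:(6,3)& 5:(7,3)\\ 6:(8,3)& 7:(9,10)& 8:(8,11)& 9:(9,12)& 10:(13,14)& 11:(11,11)\\ 12:(13,3)&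 13:(8,6)& 14:(9,15)& 15:(16,3)& 16:(9,3) \end{array}$$ Theorem. For every $n\ge 0$ and every reversed binary representation $u$ of $n$ (in particular $u=(n)_2$), the paperfolding sequence $\mathbf p$ has an unbordered factor of length $n$ if and only if $u$ is rejected by $A$. -/

import Mathlib

namespace Paperfolding

/-- The regular paperfolding sequence `p(0) p(1) p(2) ⋯` over `{1, -1}`.  Let `(n)₂` be the binary
representation of `n`, least significant digit first.  Writing `(n)₂ 0 0` as `1^i 0 a w` with
`i ≥ 0`, a digit `a` and a word `w`, we have `p(n) = (-1)^a`.  Removing the leading block `1^i`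
leaves `0 a w`, whose entry at index `1` is `a` (the default value of `getD` is never used). -/
def paperfolding (n : ℕ) : ℤ :=
  (-1) ^ (((Nat.digits 2 n ++ [0, 0]).dropWhile (fun d => d == 1)).getD 1 0)

/-- The defining property of the paperfolding sequence. -/
theorem paperfolding_eq {n i a : ℕ} {w : List ℕ}
    (h : Nat.digits 2 n ++ [0, 0] = List.replicate i 1 ++ 0 :: a :: w) :
    paperfolding n = (-1) ^ a := by
  have key : (List.replicate i 1 ++ 0 :: a :: w).dropWhile (fun d => d == 1) = 0 :: a :: w := by
    clear h
    induction i with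
    | zero => simp
    | succ i ih => simp [List.replicate_succ, ih]
  unfold paperfolding
  rw [h, key]
  simp

/-- The factor of length `n` beginning at position `j` of the infinite sequence `x`. -/
def factor {α : Type*} (x : ℕ → α) (j n : ℕ) : List α :=
  (List.range n).map (fun i => x (j + i))

/-- A word is bordered if it begins and ends with the same word `x`, where `0 < |x| ≤ |w| / 2`. -/
def IsBordered {α : Type*} (w : List α) : Prop :=
  ∃ x : List α, 0 < x.length ∧ 2 * x.length ≤ w.length ∧ x <+: w ∧ x <:+ w

/-- The sequence `x` has an unbordered factor of length `n`. -/
def HasUnborderedFactor {α : Type*} (x : ℕ → α) (n : ℕ) : Prop :=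
  ∃ j : ℕ, ¬ IsBordered (factor x j n)

/-- The word `w` over `{0, 1}` is a reversed binary representation of `n`: it is read with the
least significant digit first, and trailing zeros are allowed. -/
def IsReversedRep (w : List (Fin 2)) (n : ℕ) : Prop :=
  Nat.ofDigits 2 (w.map Fin.val) = n

/-- The transition table: row `q` lists the successors of state `q` on the digits `0` and `1`. -/
def transition : Fin 17 → Fin 2 → Fin 17 :=
  ![![1, 2],
    ![3, 4],
    ![5, 3],
    ![3, 3],
    ![6, 3],
    ![7, 3],
    ![8, 3],
    ![9, 10],
    ![8, 11],
    ![9, 12],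
    ![13, 14],
    ![11, 11],
    ![13, 3],
    ![8, 6],
    ![9, 15],
    ![16, 3],
    ![9, 3]]

/-- The 17-state automaton, with initial state `0` and `11` as its only accepting state. -/
def automaton : DFA (Fin 2) (Fin 17) where
  step := transition
  start := 0
  accept := {11}

end Paperfolding

namespace Paperfolding

/-! Shift the sequence by one and extend it to an odd function `fold` on the nonzero integers:
`fold` ignores factors of 2 and is the nontrivial character mod 4 on odd numbers. A factor starting
at `a` is unbordered iff, for each `0 < l ≤ n / 2`, the windows of length `l` at `a` and `a + (n -
l)` differ (`Mis`). Near high powers of two `fold` looks as near 0, so `a` may be any integer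
(`hasUnborderedFactor_of_mis`). A shift of 2-adic valuation `k + 1` flips the sign at every odd
multiple of `2 ^ k`, so windows of length `2 ^ (k + 1)` see it (`mis_of_odd`); a shift by `2 * y` is
seen at `-y` by oddness (`mis_of_center`). Conversely, a shift by a multiple of `2 ^ (k + 1)` is
visible only at multiples of `2 ^ k` (`Mis.exists_dvd`).

Existence: write `n = R + 2 ^ (K + 1) * M`. Among the long borders only the lengths `R + 2 ^ (K + 1)
* u` are critical; they concern the multiples of `2 ^ K`, that is, a rescaled window `[b, b + 2 *
M]` (`NoMatch`). Short borders are a finite table depending on the signs at the ends of that window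
(`hasUnborderedFactor_of_noMatch`). With signs `-1, 1` a window exists for every `M > 0`
(`exists_good`), which settles most residues of `n`. The remaining ones, apart from 2 mod 16, use
signs `1, -1`; such windows are available when the odd part of `M` is not `Obstructed`
(`exists_noMatch_of_not_obstructed`).

Nonexistence: borders 1, 2, 3 rule out `n % 16 = 2`, `n > 2`. If `n % 8 = 1` and `n > 8`, borders 1,
2, 4 force the signs `1, -1` at the ends of the factor (`ends_of_mod_eight_eq_one`). In the
exceptional classes these signs pass to the rescaled window, where obstruction is contradictory
(`false_of_obstructed`).

`AllBordered` collects the exceptional lengths, and `AcceptedFrom` gives the arithmetical meaning of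
each state of the automaton. -/

/-! ### Recurrences and the odd extension to the integers -/

theorem paperfolding_two_mul (n : ℕ) : paperfolding (2 * n) = (-1) ^ n := by
  rcases Nat.eq_zero_or_pos n with rfl | hn
  · simp [paperfolding]
  · unfold paperfolding
    rw [Nat.digits_def' (by norm_num) (by omega)]
    have h : 2 * n % 2 = 0 := by omega
    have h' : 2 * n / 2 = n := by omega
    rw [h, h', Nat.digits_def' (by norm_num) hn]
    simp only [List.cons_append, List.dropWhile_cons]
    simp [neg_one_pow_eq_pow_mod_two n]

theorem paperfolding_two_mul_add_one (n : ℕ) : paperfolding (2 * n + 1) = paperfolding n := by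
  unfold paperfolding
  rw [Nat.digits_def' (by norm_num) (by omega)]
  have h : (2 * n + 1) % 2 = 1 := by omega
  have h' : (2 * n + 1) / 2 = n := by omega
  rw [h, h']
  simp

/-- The extension of `paperfolding`, shifted by one, to an odd function on the nonzero integers. -/
noncomputable def fold (x : ℤ) : ℤ :=
  if x = 0 then 1 else x.sign * paperfolding (x.natAbs - 1)

theorem fold_zero : fold 0 = 1 := by simp [fold]

theorem fold_natCast_add_one (n : ℕ) : fold (n + 1) = paperfolding n := by
  have h : ((n : ℤ) + 1) ≠ 0 := by omega
  have h1 : ((n : ℤ) + 1).sign = 1 := Int.sign_eq_one_of_pos (by omega)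
  have h2 : ((n : ℤ) + 1).natAbs - 1 = n := by omega
  simp [fold, h, h1, h2]

theorem fold_neg {x : ℤ} (hx : x ≠ 0) : fold (-x) = -fold x := by
  simp [fold, hx]

theorem fold_two_mul (x : ℤ) : fold (2 * x) = fold x := by
  rcases eq_or_ne x 0 with rfl | hx
  · simp
  · have h : (2 * x).natAbs - 1 = 2 * (x.natAbs - 1) + 1 := by omega
    have h' : (2 * x).sign = x.sign := by
      rw [Int.sign_mul, Int.sign_eq_one_of_pos (by norm_num : (0 : ℤ) < 2), one_mul]
    simp [fold, hx, h, paperfolding_two_mul_add_one]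

theorem fold_four_mul_add_one (x : ℤ) : fold (4 * x + 1) = 1 := by
  have h0 : 4 * x + 1 ≠ 0 := by omega
  rcases le_or_gt 0 x with hx | hx
  · have h : (4 * x + 1).natAbs - 1 = 2 * (2 * x.natAbs) := by omega
    have h' : (4 * x + 1).sign = 1 := Int.sign_eq_one_of_pos (by omega)
    simp [fold, h0, h, h', paperfolding_two_mul, pow_mul]
  · have h : (4 * x + 1).natAbs - 1 = 2 * (2 * (x.natAbs - 1) + 1) := by omega
    have h' : (4 * x + 1).sign = -1 := Int.sign_eq_neg_one_of_neg (by omega)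
    rw [fold, if_neg h0, h, h', paperfolding_two_mul, pow_succ, pow_mul]
    simp

theorem fold_four_mul_add_three (x : ℤ) : fold (4 * x + 3) = -1 := by
  have h : 4 * x + 3 = -(4 * (-x - 1) + 1) := by ring
  rw [h, fold_neg (by omega), fold_four_mul_add_one]

theorem fold_of_mod_one {x : ℤ} (h : x % 4 = 1) : fold x = 1 := by
  have : x = 4 * (x / 4) + 1 := by omega
  rw [this, fold_four_mul_add_one]

theorem fold_of_mod_three {x : ℤ} (h : x % 4 = 3) : fold x = -1 := by
  have : x = 4 * (x / 4) + 3 := by omega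
  rw [this, fold_four_mul_add_three]

theorem fold_pow_mul (k : ℕ) (x : ℤ) : fold (2 ^ k * x) = fold x := by
  induction k with
  | zero => simp
  | succ k ih => rw [pow_succ', mul_assoc, fold_two_mul, ih]

theorem fold_eq_one_or (x : ℤ) : fold x = 1 ∨ fold x = -1 := by
  rcases eq_or_ne x 0 with rfl | hx
  · simp [fold]
  · have h1 : paperfolding (x.natAbs - 1) = 1 ∨ paperfolding (x.natAbs - 1) = -1 := by
      unfold paperfolding; exact neg_one_pow_eq_or ℤ _
    rcases lt_or_gt_of_ne hx with h | h
    · rcases h1 with h1 | h1 <;> simp [fold, hx, h1, Int.sign_eq_neg_one_of_neg h]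
    · rcases h1 with h1 | h1 <;> simp [fold, hx, h1, Int.sign_eq_one_of_pos h]

/-! ### Values of `fold` determined by residues -/

/-- The value of `fold` at `x` if `2 ^ k` does not divide `x`, and `0` otherwise. -/
def res : ℕ → ℤ → ℤ
  | 0, _ => 0
  | k + 1, x => if x % 2 = 0 then res k (x / 2) else if x % 4 = 1 then 1 else -1

theorem fold_of_res_ne_zero {k : ℕ} {x : ℤ} (h : res k x ≠ 0) : fold x = res k x := by
  induction k generalizing x with
  | zero => simp [res] at h
  | succ k ih =>
    rw [res] at h ⊢
    split_ifs at h ⊢ with h2 h4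
    · rw [← ih h, ← fold_two_mul (x / 2), Int.mul_ediv_cancel' (Int.dvd_of_emod_eq_zero h2)]
    · exact fold_of_mod_one h4
    · exact fold_of_mod_three (by omega)

theorem res_congr {k : ℕ} {x y : ℤ} (h : (2 : ℤ) ^ (k + 1) ∣ x - y) : res k x = res k y := by
  induction k generalizing x y with
  | zero => rfl
  | succ k ih =>
    obtain ⟨c, hc⟩ := h
    rw [pow_succ, pow_succ] at hc
    have h2 : x % 2 = y % 2 := by
      have : x - y = 2 * (2 ^ k * 2 * c) := by rw [hc]; ring
      omega
    have h4 : x % 4 = y % 4 := by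
      have : x - y = 4 * (2 ^ k * c) := by rw [hc]; ring
      omega
    rw [res, res, h2, h4]
    split_ifs with h
    · refine ih ⟨c, ?_⟩
      have h3 : x - y = 2 * (2 ^ k * 2 * c) := by rw [hc]; ring
      rw [pow_succ]
      omega
    all_goals rfl

theorem res_eq_zero_iff {k : ℕ} {x : ℤ} : res k x = 0 ↔ (2 : ℤ) ^ k ∣ x := by
  induction k generalizing x with
  | zero => simp [res]
  | succ k ih =>
    rw [res]
    split_ifs with h2 h4
    · rw [ih]
      obtain ⟨c, rfl⟩ : (2 : ℤ) ∣ x := Int.dvd_of_emod_eq_zero h2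
      rw [pow_succ', mul_dvd_mul_iff_left (by norm_num)]; simp
    · refine iff_of_false (by norm_num) fun h => h2 ?_
      exact Int.emod_eq_zero_of_dvd ((dvd_pow_self 2 (Nat.succ_ne_zero k)).trans h)
    · refine iff_of_false (by norm_num) fun h => h2 ?_
      exact Int.emod_eq_zero_of_dvd ((dvd_pow_self 2 (Nat.succ_ne_zero k)).trans h)

theorem fold_eq_res {k : ℕ} {x y : ℤ} (h : (2 : ℤ) ^ (k + 1) ∣ x - y) (hy : res k y ≠ 0) :
    fold x = res k y := by
  rw [← res_congr h] at hy ⊢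
  exact fold_of_res_ne_zero hy

/-- Adding a multiple of `2 ^ (k + 1)` does not change `fold` off the multiples of `2 ^ k`. -/
theorem fold_congr {k : ℕ} {x y : ℤ} (h : (2 : ℤ) ^ (k + 1) ∣ x - y) (hy : ¬(2 : ℤ) ^ k ∣ y) :
    fold x = fold y := by
  have h0 : res k y ≠ 0 := fun h => hy (res_eq_zero_iff.1 h)
  rw [fold_eq_res h h0, fold_of_res_ne_zero h0]

/-- Adding twice an odd number exchanges the classes 1 and 3 mod 4. -/
theorem fold_add_ne {k : ℕ} {u o : ℤ} (hu : u % 2 = 1) (ho : o % 2 = 1) :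
    fold (2 ^ k * u) ≠ fold (2 ^ k * u + 2 ^ (k + 1) * o) := by
  have h : (2 : ℤ) ^ k * u + 2 ^ (k + 1) * o = 2 ^ k * (u + 2 * o) := by ring
  rw [h, fold_pow_mul, fold_pow_mul]
  rcases (by omega : u % 4 = 1 ∨ u % 4 = 3) with h | h
  · rw [fold_of_mod_one h, fold_of_mod_three (by omega)]; norm_num
  · rw [fold_of_mod_three h, fold_of_mod_one (by omega)]; norm_num

/-! ### Shifts that a window sees -/

/-- The windows of length `l` at `a` and at `a + d` carry different words. -/
def Mis (a d l : ℤ) : Prop :=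
  ∃ x, a ≤ x ∧ x < a + l ∧ fold x ≠ fold (x + d)

theorem Mis.mono {a d l a' l' : ℤ} (h : Mis a d l) (h1 : a' ≤ a) (h2 : a + l ≤ a' + l') :
    Mis a' d l' := by
  obtain ⟨x, hx, hx', hne⟩ := h
  exact ⟨x, by omega, by omega, hne⟩

/-- A mismatch at `y` gives one at `2 ^ k * y`. -/
theorem Mis.pow_mul {b e m : ℤ} (h : Mis b e m) (k : ℕ) :
    Mis (2 ^ k * b) (2 ^ k * e) (2 ^ k * (m - 1) + 1) := by
  obtain ⟨x, hx, hx', hne⟩ := h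
  have hk : (0 : ℤ) < 2 ^ k := by positivity
  refine ⟨2 ^ k * x, by gcongr, ?_, ?_⟩
  · have : (2 : ℤ) ^ k * x ≤ 2 ^ k * (b + (m - 1)) := by gcongr; omega
    linarith
  · rwa [← mul_add, fold_pow_mul, fold_pow_mul]

/-- A shift by `2 ^ (k + 1)` times an odd number is seen by every window of length
`2 ^ (k + 1)`. -/
theorem mis_of_odd {k : ℕ} {a d l o : ℤ} (hd : d = 2 ^ (k + 1) * o) (ho : o % 2 = 1)
    (hl : 2 ^ (k + 1) ≤ l) : Mis a d l := by
  have hk : (0 : ℤ) < 2 ^ (k + 1) := by positivity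
  have hs : (2 : ℤ) ^ (k + 1) = 2 * 2 ^ k := pow_succ' 2 k
  have h1 := Int.emod_add_mul_ediv (2 ^ k - a) (2 ^ (k + 1))
  have h2 := Int.emod_nonneg (2 ^ k - a) hk.ne'
  have h3 := Int.emod_lt_of_pos (2 ^ k - a) hk
  set q := (2 ^ k - a) / 2 ^ (k + 1)
  set r := (2 ^ k - a) % 2 ^ (k + 1)
  -- `a + r` is the first odd multiple of `2 ^ k` in the window.
  have h4 : a + r = 2 ^ k * (1 - 2 * q) := by linear_combination h1 - q * hs
  refine ⟨a + r, by omega, by omega, ?_⟩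
  rw [h4, hd]
  exact fold_add_ne (by omega) ho

/-- A shift by `2 y` is seen by a window that contains `-y`. -/
theorem mis_of_center {a d l y : ℤ} (hd : d = 2 * y) (hy : y ≠ 0) (h1 : a ≤ -y)
    (h2 : -y < a + l) : Mis a d l := by
  refine ⟨-y, h1, h2, ?_⟩
  rw [hd, show -y + 2 * y = y by ring, fold_neg hy]
  rcases fold_eq_one_or y with h | h <;> rw [h] <;> norm_num

/-- Since `res` is 0 where the residue does not determine the sign, a product `-1` certifies two
known and opposite signs. This turns mismatches into decidable checks. -/
theorem mis_of_res {j k : ℕ} {a d a₀ d₀ l₁ : ℤ} {l : ℕ} (ha : (2 : ℤ) ^ (j + 1) ∣ a - a₀)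
    (hd : (2 : ℤ) ^ (k + 1) ∣ a + d - (a₀ + d₀)) (hl : (l : ℤ) ≤ l₁)
    (h : ∃ i < l, res j (a₀ + i) * res k (a₀ + d₀ + i) = -1) : Mis a d l₁ := by
  obtain ⟨i, hi, h⟩ := h
  refine ⟨a + i, by omega, by omega, ?_⟩
  have h1 : res j (a₀ + i) ≠ 0 := fun h0 => by simp [h0] at h
  have h2 : res k (a₀ + d₀ + i) ≠ 0 := fun h0 => by simp [h0] at h
  rw [fold_eq_res (k := j) (y := a₀ + i) (by convert ha using 1; ring) h1,
    fold_eq_res (k := k) (y := a₀ + d₀ + i) (by convert hd using 1; ring) h2]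
  intro h3
  rw [h3] at h
  nlinarith [mul_self_nonneg (res k (a₀ + d₀ + i))]

/-- A shift by an odd number is seen by every window of length at least `7`. -/
theorem mis_of_shift_odd {a d l : ℤ} (hd : d % 2 = 1) (hl : 7 ≤ l) : Mis a d l := by
  have key : ∀ r < 8, ∀ s < 8, (s : ℕ) % 2 = 1 →
      ∃ i < 7, res 2 ((r : ℕ) + (i : ℕ)) * res 2 ((r : ℕ) + s + i) = -1 := by decide
  obtain ⟨r, hr⟩ : ∃ r : ℕ, (r : ℤ) = a % 8 := ⟨(a % 8).toNat, by omega⟩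
  obtain ⟨s, hs⟩ : ∃ s : ℕ, (s : ℤ) = d % 8 := ⟨(d % 8).toNat, by omega⟩
  exact mis_of_res (j := 2) (k := 2) (l := 7) (a₀ := r) (d₀ := s) (by norm_num; omega)
    (by norm_num; omega) (by exact_mod_cast hl)
    (key r (by omega) s (by omega) (by omega))

/-! ### Borders as pairs of equal windows -/

theorem length_factor {α : Type*} (x : ℕ → α) (j n : ℕ) : (factor x j n).length = n := by
  simp [factor]

theorem isBordered_factor_iff {α : Type*} (x : ℕ → α) (j n : ℕ) :
    IsBordered (factor x j n) ↔
      ∃ l, 0 < l ∧ 2 * l ≤ n ∧ ∀ i < l, x (j + i) = x (j + (n - l) + i) := by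
  have take_eq (l : ℕ) (hl : l ≤ n) : (factor x j n).take l = factor x j l := by
    simp [factor, ← List.map_take, List.take_range, hl]
  have drop_eq (l : ℕ) (hl : l ≤ n) : (factor x j n).drop (n - l) = factor x (j + (n - l)) l := by
    apply List.ext_getElem
    · simp [factor]; omega
    · intro i h1 h2
      simp [factor, add_assoc]
  have eq_iff (l : ℕ) : factor x j l = factor x (j + (n - l)) l ↔
      ∀ i < l, x (j + i) = x (j + (n - l) + i) := by
    simp [factor, List.map_inj_left]
  constructor
  · rintro ⟨v, h0, h2, hp, hs⟩
    rw [length_factor] at h2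
    refine ⟨v.length, h0, h2, (eq_iff _).1 ?_⟩
    rw [← take_eq _ (by omega), ← drop_eq _ (by omega), ← List.prefix_iff_eq_take.1 hp]
    rw [List.suffix_iff_eq_drop, length_factor] at hs
    exact hs
  · rintro ⟨l, h0, h2, h⟩
    refine ⟨factor x j l, by rwa [length_factor], by rw [length_factor, length_factor]; exact h2,
      ?_, ?_⟩
    · rw [← take_eq l (by omega)]; exact List.take_prefix _ _
    · rw [(eq_iff l).2 h, ← drop_eq l (by omega)]; exact List.drop_suffix _ _

theorem not_isBordered_iff_mis (j n : ℕ) :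
    ¬IsBordered (factor paperfolding j n) ↔
      ∀ l : ℤ, 0 < l → 2 * l ≤ n → Mis (j + 1) (n - l) l := by
  rw [isBordered_factor_iff]
  push Not
  constructor
  · intro h l h0 h2
    lift l to ℕ using h0.le
    obtain ⟨i, hi, hne⟩ := h l (by exact_mod_cast h0) (by exact_mod_cast h2)
    refine ⟨((j + i : ℕ) : ℤ) + 1, by push_cast; omega, by push_cast; omega, ?_⟩
    have h3 : ((j + i : ℕ) : ℤ) + 1 + (n - l) = ((j + (n - l) + i : ℕ) : ℤ) + 1 := by
      push_cast [Nat.cast_sub (show l ≤ n by omega)]; ring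
    rwa [h3, fold_natCast_add_one, fold_natCast_add_one]
  · intro h l h0 h2
    obtain ⟨x, hx, hx', hne⟩ := h l (by exact_mod_cast h0) (by exact_mod_cast h2)
    obtain ⟨i, hi⟩ : ∃ i : ℕ, (i : ℤ) = x - (j + 1) := ⟨(x - (j + 1)).toNat, by omega⟩
    refine ⟨i, by omega, ?_⟩
    have h3 : x = ((j + i : ℕ) : ℤ) + 1 := by push_cast; omega
    have h4 : x + (n - l) = ((j + (n - l) + i : ℕ) : ℤ) + 1 := by
      push_cast [Nat.cast_sub (show l ≤ n by omega)]; omega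
    rwa [h4, h3, fold_natCast_add_one, fold_natCast_add_one] at hne

/-- Near a multiple of a large power of two, `fold` looks as it does near `0`. -/
theorem fold_pow_add {N : ℕ} {x : ℤ} (hx : |x| < 2 ^ N) : fold (2 ^ (N + 2) + x) = fold x := by
  rcases eq_or_ne x 0 with rfl | h0
  -- The convention `fold 0 = 1` matters here: it agrees with the sign at a power of two.
  · have := fold_pow_mul (N + 2) 1
    rw [mul_one] at this
    rw [add_zero, this, fold_zero, fold_of_mod_one (by norm_num)]
  · refine fold_congr (k := N) ⟨2, by ring⟩ fun h => ?_
    have := Int.le_of_dvd (abs_pos.2 h0) ((dvd_abs _ _).2 h)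
    omega

theorem hasUnborderedFactor_of_mis {n : ℕ} (a : ℤ)
    (h : ∀ l : ℤ, 0 < l → 2 * l ≤ n → Mis a (n - l) l) : HasUnborderedFactor paperfolding n := by
  set N := a.natAbs + n + 1 with hN
  have hlt : ((a.natAbs : ℤ) + n + 1) < 2 ^ N := by
    have := Nat.lt_two_pow_self (n := N)
    have h2 : (N : ℤ) < 2 ^ N := by exact_mod_cast this
    rw [hN] at h2 ⊢; push_cast at h2 ⊢; exact h2
  have h4 : (2 : ℤ) ^ (N + 2) = 4 * 2 ^ N := by ring
  obtain ⟨j, hj⟩ : ∃ j : ℕ, (j : ℤ) = 2 ^ (N + 2) + a - 1 :=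
    ⟨(2 ^ (N + 2) + a - 1).toNat, by omega⟩
  refine ⟨j, (not_isBordered_iff_mis j n).2 fun l h0 h2 => ?_⟩
  obtain ⟨x, hx, hx', hne⟩ := h l h0 h2
  refine ⟨2 ^ (N + 2) + x, by omega, by omega, ?_⟩
  rw [add_assoc ((2 : ℤ) ^ (N + 2)), fold_pow_add (abs_lt.2 ⟨by omega, by omega⟩),
    fold_pow_add (abs_lt.2 ⟨by omega, by omega⟩)]
  exact hne

/-- The shift has the same valuation `v` as `r`, since `v < K`, and `2 ^ v ≤ r ≤ l`, so `mis_of_odd`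
applies. -/
theorem mis_of_sub {K : ℕ} {a d l M r : ℤ} (hd : d = 2 ^ K * M - r) (hr : 0 < r)
    (hr2 : r % 2 = 0) (hK : ¬(2 : ℤ) ^ K ∣ r) (hl : r ≤ l) : Mis a d l := by
  lift r to ℕ using hr.le
  obtain ⟨v, o, ho, hv⟩ := Nat.exists_eq_two_pow_mul_odd (n := r) (by omega)
  obtain ⟨c, hc⟩ := ho
  have hvK : v < K := by
    by_contra! h
    exact hK (by rw [hv]; push_cast; exact (pow_dvd_pow 2 h).mul_right _)
  obtain ⟨e, rfl⟩ : ∃ e, K = v + 1 + e := ⟨K - (v + 1), by omega⟩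
  cases v with
  | zero => omega
  | succ v =>
    refine mis_of_odd (k := v) (o := 2 * (2 ^ e * M) - o) ?_ (by omega) ?_
    · rw [hd, hv]; push_cast; ring
    · refine le_trans ?_ hl
      rw [hv]
      have : 1 ≤ o := by omega
      exact_mod_cast Nat.le_mul_of_pos_right _ this

/-! ### Reduction to windows of multiples of a power of two -/

/-- All relevant shifts of `[b, b + 2 M]` by a multiple of `2` are seen. -/
def NoMatch (b M : ℤ) : Prop :=
  ∀ u, 1 ≤ u → 2 * u < M → Mis b (2 * (M - u)) (2 * u + 1)

/-- The value of `fold (c + x)`, if it can be determined, for `c` divisible by a large power of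
two and `fold c = s`. -/
def val (s : ℤ) (k : ℕ) (x : ℤ) : ℤ := if x = 0 then s else res k x

theorem fold_add_eq_val {k : ℕ} {c x s : ℤ} (hc : (2 : ℤ) ^ (k + 1) ∣ c) (hs : fold c = s)
    (h : val s k x ≠ 0) : fold (c + x) = val s k x := by
  unfold val at h ⊢
  split_ifs at h ⊢ with h0
  · rw [h0, add_zero, hs]
  · exact fold_eq_res (by simpa using hc) h

/-- If `n = R + 2 ^ (K + 1) * M` and the window of multiples of `2 ^ K` is good, then only borders
of bounded length need to be excluded. -/
theorem hasUnborderedFactor_of_noMatch {n R K : ℕ} {M b t s : ℤ} {j k : ℕ}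
    (hn : (n : ℤ) = R + 2 ^ (K + 1) * M) (hb : fold b = s) (hb' : fold (b + 2 * M) = -s)
    (hbM : NoMatch b M) (ht : t ≤ 0) (ht' : 0 < t + R) (hj : (2 : ℤ) ^ (j + 1) ∣ 2 ^ K * b)
    (hk : (2 : ℤ) ^ (k + 1) ∣ 2 ^ K * (b + 2 * M))
    (table : ∀ l < max R 6, ∃ i < l + 1,
      val s j (t + (i : ℕ)) * val (-s) k (t + R - ((l : ℕ) + 1) + i) = -1) :
    HasUnborderedFactor paperfolding n := by
  refine hasUnborderedFactor_of_mis (2 ^ K * b + t) fun l h0 h2 => ?_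
  rcases le_or_gt l (max R 6 : ℕ) with hl | hl
  · obtain ⟨m, rfl⟩ : ∃ m : ℕ, l = m + 1 := ⟨(l - 1).toNat, by omega⟩
    obtain ⟨i, hi, h⟩ := table m (by omega)
    have h1 : val s j (t + i) ≠ 0 := fun h0 => by simp [h0] at h
    have h2 : val (-s) k (t + R - (m + 1) + i) ≠ 0 := fun h0 => by simp [h0] at h
    refine ⟨2 ^ K * b + (t + i), by omega, by omega, ?_⟩
    have h3 : 2 ^ K * b + (t + i) + (n - ((m : ℤ) + 1)) =
        2 ^ K * (b + 2 * M) + (t + R - (m + 1) + i) := by rw [hn, pow_succ]; ring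
    rw [h3, fold_add_eq_val hj (by rw [fold_pow_mul, hb]) h1,
      fold_add_eq_val hk (by rw [fold_pow_mul, hb']) h2]
    intro h4
    rw [h4] at h
    nlinarith [mul_self_nonneg (val (-s) k (t + R - (m + 1) + i))]
  · have hlR : (R : ℤ) < l := by omega
    have hl7 : 7 ≤ l := by omega
    -- Odd shifts need only length 7, whence the bound 6 in the table. For even shifts the valuation
    -- is that of `l - R`, unless `2 ^ (K + 1)` divides it; then the mismatch is taken at multiples
    -- of `2 ^ K`, from `hbM`.
    rcases Int.emod_two_eq_zero_or_one (n - l) with hp | hp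
    · have hd : (n : ℤ) - l = 2 ^ (K + 1) * M - (l - R) := by rw [hn]; ring
      by_cases hdvd : (2 : ℤ) ^ (K + 1) ∣ l - R
      · obtain ⟨q, hq⟩ := hdvd
        have hK : (0 : ℤ) < 2 ^ (K + 1) := by positivity
        have hq1 : 0 < q := by
          by_contra! h
          have := mul_nonpos_of_nonneg_of_nonpos hK.le h
          omega
        have hqM : 2 * q < M := by
          have h5 : 2 ^ (K + 1) * (2 * q) < 2 ^ (K + 1) * M := by
            have : (2 : ℤ) ^ (K + 1) * (2 * q) = 2 * (l - R) := by rw [hq]; ring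
            omega
          exact lt_of_mul_lt_mul_left h5 hK.le
        have h6 := (hbM q hq1 hqM).pow_mul K
        have h7 : (2 : ℤ) ^ K * (2 * (M - q)) = n - l := by rw [hd, hq, pow_succ]; ring
        rw [h7] at h6
        refine h6.mono (by omega) ?_
        have h8 : (2 : ℤ) ^ K * (2 * q + 1 - 1) = l - R := by rw [hq, pow_succ]; ring
        omega
      · have : (2 : ℤ) ∣ 2 ^ (K + 1) * M := (dvd_pow_self 2 (Nat.succ_ne_zero K)).mul_right _
        exact mis_of_sub hd (by omega) (by omega) hdvd (by omega)
    · exact mis_of_shift_odd hp hl7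

/-! ### Good windows of every length -/

/-- A window nearly symmetric about 0 contains the point `-(M - u)`, where oddness of `fold` shows
the shift by `2 * (M - u)`. -/
theorem noMatch_center {b M e : ℤ} (hb : b = -(M + e)) (h1 : -1 ≤ e) (h2 : e ≤ 1) :
    NoMatch b M := fun u hu huM =>
  mis_of_center rfl (by omega) (by omega) (by omega)

/-- `NoMatch` passes from `w` to `c + 2 ^ k * w`. -/
theorem NoMatch.lift {k : ℕ} {c w b β : ℤ} (h : NoMatch β w) (hne : fold β ≠ fold (β + 2 * w))
    (hb : b ≤ 2 ^ k * β) (hb' : 2 ^ k * β ≤ b + 2 * c)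
    (small : ∀ u, 1 ≤ u → u < c → Mis b (2 * (c + 2 ^ k * w - u)) (2 * u + 1)) :
    NoMatch b (c + 2 ^ k * w) := by
  intro u hu huM
  have hk : (0 : ℤ) < 2 ^ k := by positivity
  rcases lt_or_ge u c with huc | huc
  · exact small u hu huc
  by_cases hdvd : (2 : ℤ) ^ k ∣ u - c
  · obtain ⟨q, hq⟩ := hdvd
    have hq0 : 0 ≤ q := by
      by_contra! h
      have := mul_neg_of_pos_of_neg hk h
      omega
    have h7 : (2 : ℤ) ^ k * (2 * (w - q)) = 2 * (c + 2 ^ k * w - u) := by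
      linear_combination 2 * hq
    have hβ : Mis β (2 * (w - q)) (2 * q + 1) := by
      -- For `q = 0` the window is the single point `β`, and the differing end signs are the
      -- mismatch.
      rcases hq0.eq_or_lt with h0 | h0
      · exact ⟨β, le_rfl, by omega, by rwa [← h0, sub_zero]⟩
      · refine h q h0 ?_
        have h5 : 2 ^ k * (2 * q) < 2 ^ k * w := by
          have : (2 : ℤ) ^ k * (2 * q) = 2 * (u - c) := by rw [hq]; ring
          omega
        exact lt_of_mul_lt_mul_left h5 hk.le
    have h6 := hβ.pow_mul k
    rw [h7] at h6
    have h8 : (2 : ℤ) ^ k * (2 * q + 1 - 1) = 2 * (u - c) := by rw [hq]; ring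
    exact h6.mono hb (by omega)
  · refine mis_of_sub (K := k + 1) (M := w) (r := 2 * (u - c)) (by ring) ?_ (by omega) ?_
      (by omega)
    · rcases huc.eq_or_lt with h0 | h0
      · exact absurd ⟨0, by omega⟩ hdvd
      · omega
    · rwa [pow_succ', mul_dvd_mul_iff_left (by norm_num)]

theorem noMatch_of_small {M b e m : ℤ} (hb : b = -(M + e)) (h1 : -m ≤ e) (h2 : e ≤ m)
    (small : ∀ u, 1 ≤ u → u < m → Mis b (2 * (M - u)) (2 * u + 1)) : NoMatch b M := by
  intro u hu huM
  rcases lt_or_ge u m with h | h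
  · exact small u hu h
  · exact mis_of_center rfl (by omega) (by omega) (by omega)

/-- `[b, b + 2 M]` sees all relevant shifts, and has the signs `-1` and `1` at its ends. -/
def Good (b M : ℤ) : Prop :=
  fold b = -1 ∧ fold (b + 2 * M) = 1 ∧ NoMatch b M

theorem Good.lift {k : ℕ} {c w b β : ℤ} (h : Good β w) (h0 : fold b = -1)
    (h1 : fold (b + 2 * (c + 2 ^ k * w)) = 1) (hb : b ≤ 2 ^ k * β) (hb' : 2 ^ k * β ≤ b + 2 * c)
    (small : ∀ u, 1 ≤ u → u < c → Mis b (2 * (c + 2 ^ k * w - u)) (2 * u + 1)) :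
    Good b (c + 2 ^ k * w) :=
  ⟨h0, h1, h.2.2.lift (by rw [h.1, h.2.1]; norm_num) hb hb' small⟩

theorem fold_eq_of_res (k : ℕ) {x : ℤ} (y : ℤ) {s : ℤ} (h : (2 : ℤ) ^ (k + 1) ∣ x - y)
    (hs : res k y = s) (h0 : s ≠ 0) : fold x = s := by
  rw [fold_eq_res h (by rwa [hs]), hs]

/-- An even start saves one position over `mis_of_odd`: three consecutive places already contain a
number congruent to 2 mod 4. -/
theorem mis_of_even {a d l : ℤ} (ha : a % 2 = 0) (hd : d % 8 = 4) (hl : 3 ≤ l) : Mis a d l := by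
  obtain ⟨y, hy, hy', h4⟩ : ∃ y, a ≤ y ∧ y < a + l ∧ y % 4 = 2 := by
    rcases (by omega : a % 4 = 2 ∨ a % 4 = 0) with h | h
    · exact ⟨a, by omega, by omega, h⟩
    · exact ⟨a + 2, by omega, by omega, by omega⟩
  refine ⟨y, hy, hy', ?_⟩
  have := fold_add_ne (k := 1) (u := y / 2) (o := d / 4) (by omega) (by omega)
  rwa [show (2 : ℤ) ^ 1 * (y / 2) = y by omega, show (2 : ℤ) ^ (1 + 1) * (d / 4) = d by omega]
    at this

theorem good_two_mul {β w : ℤ} (h : Good β w) : Good (2 * β) (2 * w) := by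
  have := h.lift (k := 1) (c := 0) (b := 2 * β) (by rw [fold_two_mul, h.1])
    (by rw [show 2 * β + 2 * (0 + 2 ^ 1 * w) = 2 * (β + 2 * w) by ring, fold_two_mul, h.2.1])
    (by omega) (by omega) (fun u h1 h2 => by omega)
  simpa using this

theorem good_one_add_eight_mul {β w : ℤ} (h : Good β w) :
    Good (8 * β) (1 + 8 * w) ∧ Good (8 * β - 2) (1 + 8 * w) := by
  constructor
  · refine h.lift (k := 3) (c := 1) ?_ ?_ (by omega) (by omega) (fun u h1 h2 => by omega)
    · rw [show 8 * β = 2 ^ 3 * β by ring, fold_pow_mul, h.1]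
    · exact fold_eq_of_res 2 2 (by norm_num; omega) (by decide) (by decide)
  · refine h.lift (k := 3) (c := 1) ?_ ?_ (by omega) (by omega) (fun u h1 h2 => by omega)
    · exact fold_eq_of_res 2 (-2) (by norm_num) (by decide) (by decide)
    · rw [show 8 * β - 2 + 2 * (1 + 2 ^ 3 * w) = 2 ^ 3 * (β + 2 * w) by ring, fold_pow_mul, h.2.1]

/-- The only `u < 5` not settled by the valuation of the shift is `u = 1`; there the point `8 * β`
is sent to `8 * (β + 1 + 2 * w)`, whose sign is known from the condition mod 4. -/
theorem good_five_add_eight_mul {β w : ℤ} (h : Good β w) (h1 : (β + 2 * w) % 4 = 0) :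
    Good (8 * β) (5 + 8 * w) ∧ Good (8 * β - 2) (5 + 8 * w) := by
  have h2 : fold (β + 1 + 2 * w) = 1 := fold_of_mod_one (by omega)
  have h3 : fold (8 * β) = -1 := by rw [show 8 * β = 2 ^ 3 * β by ring, fold_pow_mul, h.1]
  have small : ∀ b : ℤ, b = 8 * β ∨ b = 8 * β - 2 → ∀ u : ℤ, 1 ≤ u → u < 5 →
      Mis b (2 * (5 + 2 ^ 3 * w - u)) (2 * u + 1) := by
    intro b hb u hu hu5
    rcases (by omega : u = 1 ∨ u = 3 ∨ u % 2 = 0) with rfl | rfl | h4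
    · refine ⟨8 * β, by omega, by omega, ?_⟩
      rw [show 8 * β + 2 * (5 + 2 ^ 3 * w - 1) = 2 ^ 3 * (β + 1 + 2 * w) by ring, fold_pow_mul,
        h2, h3]
      norm_num
    · exact mis_of_odd (k := 1) (o := 1 + 4 * w) (by ring) (by omega) (by norm_num)
    · exact mis_of_odd (k := 0) (o := 5 + 2 ^ 3 * w - u) (by ring) (by omega) (by norm_num; omega)
  constructor
  · refine h.lift (k := 3) (c := 5) h3 ?_ (by omega) (by omega) (small _ (Or.inl rfl))
    rw [show 8 * β + 2 * (5 + 2 ^ 3 * w) = 2 * (4 * (1 + β + 2 * w) + 1) by ring, fold_two_mul]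
    exact fold_of_mod_one (by omega)
  · refine h.lift (k := 3) (c := 5) ?_ ?_ (by omega) (by omega) (small _ (Or.inr rfl))
    · exact fold_eq_of_res 2 (-2) (by norm_num) (by decide) (by decide)
    · rw [show 8 * β - 2 + 2 * (5 + 2 ^ 3 * w) = 2 ^ 3 * (β + 1 + 2 * w) by ring, fold_pow_mul, h2]

/-- The critical value is `u = 3`: the odd multiple `32 * β - 16` of 16 is sent to the right end of
the rescaled window, where the sign is 1. -/
theorem good_eleven_add {β w : ℤ} (h : Good β w) (h1 : β % 2 = 0) :
    Good (32 * β - 20) (11 + 32 * w) ∧ Good (32 * β - 18) (11 + 32 * w) := by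
  have small : ∀ b : ℤ, b = 32 * β - 20 ∨ b = 32 * β - 18 → ∀ u : ℤ, 1 ≤ u → u < 11 →
      Mis b (2 * (11 + 2 ^ 5 * w - u)) (2 * u + 1) := by
    intro b hb u hu hu5
    rcases (by omega : u = 3 ∨ u = 7 ∨ u % 4 = 1 ∨ u % 2 = 0) with rfl | rfl | h4 | h4
    · refine ⟨32 * β - 16, by omega, by omega, ?_⟩
      rw [show 32 * β - 16 + 2 * (11 + 2 ^ 5 * w - 3) = 2 ^ 5 * (β + 2 * w) by ring,
        show 32 * β - 16 = 2 ^ 4 * (2 * β - 1) by ring, fold_pow_mul, fold_pow_mul, h.2.1,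
        fold_of_mod_three (by omega)]
      norm_num
    · exact mis_of_odd (k := 2) (o := 1 + 8 * w) (by ring) (by omega) (by norm_num)
    · exact mis_of_even (by omega) (by omega) (by omega)
    · exact mis_of_odd (k := 0) (o := 11 + 2 ^ 5 * w - u) (by ring) (by omega) (by norm_num; omega)
  constructor
  · exact h.lift (k := 5) (c := 11) (b := 32 * β - 20)
      (fold_eq_of_res 3 (-20) (by norm_num; omega) (by decide) (by decide))
      (fold_eq_of_res 3 2 (by norm_num; omega) (by decide) (by decide))
      (by omega) (by omega) (small _ (Or.inl rfl))
  · exact h.lift (k := 5) (c := 11) (b := 32 * β - 18)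
      (fold_eq_of_res 3 (-18) (by norm_num; omega) (by decide) (by decide))
      (fold_eq_of_res 3 4 (by norm_num; omega) (by decide) (by decide))
      (by omega) (by omega) (small _ (Or.inr rfl))

/-- The critical values are `u = 3` and `u = 11`, seen at `32 * β - 32` and `32 * β - 16`; all other
`u < 27` follow from the valuation of the shift. -/
theorem good_twentySeven_add {β w : ℤ} (h : Good β w) (h1 : β % 4 = 0) :
    Good (32 * β - 36) (27 + 32 * w) ∧ Good (32 * β - 34) (27 + 32 * w) := by
  have small : ∀ b : ℤ, b = 32 * β - 36 ∨ b = 32 * β - 34 → ∀ u : ℤ, 1 ≤ u → u < 27 →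
      Mis b (2 * (27 + 2 ^ 5 * w - u)) (2 * u + 1) := by
    intro b hb u hu hu5
    rcases (by omega : u = 3 ∨ u = 11 ∨ u = 19 ∨ u % 8 = 7 ∨ u % 4 = 1 ∨ u % 2 = 0) with
      rfl | rfl | rfl | h4 | h4 | h4
    · refine ⟨32 * β - 32, by omega, by omega, ?_⟩
      rw [show 32 * β - 32 + 2 * (27 + 2 ^ 5 * w - 3) = 2 ^ 4 * (2 * β + 1 + 4 * w) by ring,
        show 32 * β - 32 = 2 ^ 5 * (β - 1) by ring, fold_pow_mul, fold_pow_mul,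
        fold_of_mod_three (by omega), fold_of_mod_one (by omega)]
      norm_num
    · refine ⟨32 * β - 16, by omega, by omega, ?_⟩
      have := fold_add_ne (k := 4) (u := 2 * β - 1) (o := 1 + 2 * w) (by omega) (by omega)
      rwa [show 32 * β - 16 = 2 ^ 4 * (2 * β - 1) by ring,
        show 2 * (27 + 2 ^ 5 * w - 11) = 2 ^ (4 + 1) * (1 + 2 * w) by ring]
    · exact mis_of_odd (k := 3) (o := 1 + 4 * w) (by ring) (by omega) (by norm_num)
    · exact mis_of_odd (k := 2) (o := (27 + 2 ^ 5 * w - u) / 4) (by omega) (by omega)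
        (by norm_num; omega)
    · exact mis_of_even (by omega) (by omega) (by omega)
    · exact mis_of_odd (k := 0) (o := 27 + 2 ^ 5 * w - u) (by ring) (by omega) (by norm_num; omega)
  constructor
  · exact h.lift (k := 5) (c := 27) (b := 32 * β - 36)
      (fold_eq_of_res 3 (-4) (by norm_num; omega) (by decide) (by decide))
      (fold_eq_of_res 3 2 (by norm_num; omega) (by decide) (by decide))
      (by omega) (by omega) (small _ (Or.inl rfl))
  · exact h.lift (k := 5) (c := 27) (b := 32 * β - 34)
      (fold_eq_of_res 3 (-2) (by norm_num; omega) (by decide) (by decide))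
      (fold_eq_of_res 3 4 (by norm_num; omega) (by decide) (by decide))
      (by omega) (by omega) (small _ (Or.inr rfl))

theorem good_of_mod_sixteen_eq_three {M : ℤ} (hM : M % 16 = 3) :
    Good (-(M + 1)) M ∧ Good (-(M + -1)) M :=
  ⟨⟨fold_eq_of_res 3 (-4) (by norm_num; omega) (by decide) (by decide),
    fold_eq_of_res 3 2 (by norm_num; omega) (by decide) (by decide),
    noMatch_center rfl (by norm_num) (by norm_num)⟩,
  ⟨fold_eq_of_res 3 (-2) (by norm_num; omega) (by decide) (by decide),
    fold_eq_of_res 3 4 (by norm_num; omega) (by decide) (by decide),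
    noMatch_center rfl (by norm_num) (by norm_num)⟩⟩

theorem good_of_mod_sixteen_eq_seven {M : ℤ} (hM : M % 16 = 7) :
    Good (-(M + -3)) M ∧ Good (-(M + 3)) M := by
  have small : ∀ b : ℤ, b % 4 = 0 ∨ b % 4 = 2 → ∀ u : ℤ, 1 ≤ u → u < 3 →
      Mis b (2 * (M - u)) (2 * u + 1) := by
    intro b hb u hu hu3
    rcases (by omega : u = 1 ∨ u = 2) with rfl | rfl
    · exact mis_of_even (by omega) (by omega) (by omega)
    · exact mis_of_odd (k := 0) (o := M - 2) (by ring) (by omega) (by norm_num)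
  exact ⟨⟨fold_eq_of_res 3 (-4) (by norm_num; omega) (by decide) (by decide),
    fold_eq_of_res 3 10 (by norm_num; omega) (by decide) (by decide),
    noMatch_of_small (m := 3) rfl (by norm_num) (by norm_num) (small _ (by omega))⟩,
   ⟨fold_eq_of_res 3 (-10) (by norm_num; omega) (by decide) (by decide),
    fold_eq_of_res 3 4 (by norm_num; omega) (by decide) (by decide),
    noMatch_of_small (m := 3) rfl (by norm_num) (by norm_num) (small _ (by omega))⟩⟩

theorem good_of_mod_sixteen_eq_fifteen {M : ℤ} (hM : M % 16 = 15) :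
    Good (-(M + 5)) M ∧ Good (-(M + -5)) M := by
  have small : ∀ b : ℤ, b % 16 = 12 ∨ b % 16 = 6 → ∀ u : ℤ, 1 ≤ u → u < 5 →
      Mis b (2 * (M - u)) (2 * u + 1) := by
    intro b hb u hu hu3
    rcases (by omega : u = 1 ∨ u = 3 ∨ u % 2 = 0) with rfl | rfl | h
    · rcases hb with hb | hb
      · exact mis_of_res (j := 3) (k := 3) (a₀ := 12) (d₀ := 12) (l := 3) (by norm_num; omega)
          (by norm_num; omega) (by norm_num) (by decide)
      · exact mis_of_res (j := 3) (k := 3) (a₀ := 6) (d₀ := 12) (l := 3) (by norm_num; omega)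
          (by norm_num; omega) (by norm_num) (by decide)
    · rcases hb with hb | hb
      · exact mis_of_res (j := 3) (k := 3) (a₀ := 12) (d₀ := 8) (l := 7) (by norm_num; omega)
          (by norm_num; omega) (by norm_num) (by decide)
      · exact mis_of_res (j := 3) (k := 3) (a₀ := 6) (d₀ := 8) (l := 7) (by norm_num; omega)
          (by norm_num; omega) (by norm_num) (by decide)
    · exact mis_of_odd (k := 0) (o := M - u) (by ring) (by omega) (by norm_num; omega)
  exact ⟨⟨fold_eq_of_res 3 12 (by norm_num; omega) (by decide) (by decide),
    fold_eq_of_res 3 10 (by norm_num; omega) (by decide) (by decide),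
    noMatch_of_small (m := 5) rfl (by norm_num) (by norm_num) (small _ (by omega))⟩,
   ⟨fold_eq_of_res 3 6 (by norm_num; omega) (by decide) (by decide),
    fold_eq_of_res 3 4 (by norm_num; omega) (by decide) (by decide),
    noMatch_of_small (m := 5) rfl (by norm_num) (by norm_num) (small _ (by omega))⟩⟩

theorem good_of_res {b M : ℕ} (h0 : res 10 b = -1) (h1 : res 10 (b + 2 * M) = 1)
    (h : ∀ u < M / 2, ∃ i < 2 * u + 3,
      res 10 ((b : ℤ) + (i : ℕ)) * res 10 ((b : ℤ) + 2 * (M - (u + 1)) + (i : ℕ)) = -1) :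
    Good b M := by
  refine ⟨fold_eq_of_res 10 b (by simp) h0 (by norm_num),
    fold_eq_of_res 10 (b + 2 * M) (by simp) h1 (by norm_num), fun u hu huM => ?_⟩
  obtain ⟨v, rfl⟩ : ∃ v : ℕ, u = v + 1 := ⟨(u - 1).toNat, by omega⟩
  exact mis_of_res (j := 10) (k := 10) (by simp) (by simp) (by push_cast; omega) (h v (by omega))

/-- Good windows exist for every length, starting at a multiple of `4`, and for odd lengths also
starting at `2` modulo `4`. -/
theorem exists_good (M : ℕ) (hM : 0 < M) :
    (∃ b : ℤ, b % 4 = 0 ∧ Good b M) ∧ (M % 2 = 1 → ∃ b : ℤ, b % 4 = 2 ∧ Good b M) := by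
  induction M using Nat.strong_induction_on with
  | _ M ih =>
  rcases Nat.mod_two_eq_zero_or_one M with h2 | h2
  · obtain ⟨w, rfl⟩ : ∃ w, M = 2 * w := ⟨M / 2, by omega⟩
    refine ⟨?_, fun h => by omega⟩
    obtain ⟨β, hβ, hg⟩ := (ih w (by omega) (by omega)).1
    exact ⟨2 * β, by omega, by exact_mod_cast good_two_mul hg⟩
  suffices h : ∃ b c : ℤ, b % 4 = 0 ∧ c % 4 = 2 ∧ Good b M ∧ Good c M by
    obtain ⟨b, c, hb, hc, hg, hg'⟩ := h
    exact ⟨⟨b, hb, hg⟩, fun _ => ⟨c, hc, hg'⟩⟩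
  -- The classes 3, 7, 15 mod 16 have nearly symmetric windows; 1, 5 mod 8 descend to `M / 8`, and
  -- 11, 27 mod 32 descend to `M / 32`.
  obtain hm | hm | hm | hm | hm | hm | hm : M % 8 = 1 ∨ M % 8 = 5 ∨ M % 16 = 3 ∨ M % 16 = 7 ∨
      M % 16 = 15 ∨ M % 32 = 11 ∨ M % 32 = 27 := by omega
  · obtain ⟨w, rfl⟩ : ∃ w, M = 1 + 8 * w := ⟨M / 8, by omega⟩
    rcases Nat.eq_zero_or_pos w with rfl | hw
    · exact ⟨(24 : ℕ), (6 : ℕ), by norm_num, by norm_num, good_of_res (by decide) (by decide)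
        (by decide), good_of_res (by decide) (by decide) (by decide)⟩
    · obtain ⟨β, -, hg⟩ := (ih w (by omega) hw).1
      exact ⟨8 * β, 8 * β - 2, by omega, by omega, by exact_mod_cast (good_one_add_eight_mul hg).1,
        by exact_mod_cast (good_one_add_eight_mul hg).2⟩
  · obtain ⟨w, rfl⟩ : ∃ w, M = 5 + 8 * w := ⟨M / 8, by omega⟩
    rcases Nat.eq_zero_or_pos w with rfl | hw
    · exact ⟨(24 : ℕ), (22 : ℕ), by norm_num, by norm_num, good_of_res (by decide) (by decide)
        (by decide), good_of_res (by decide) (by decide) (by decide)⟩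
    -- The second half of the induction hypothesis serves here: for odd `w` the start must be 2 mod
    -- 4.
    · obtain ⟨β, hβ, hg⟩ : ∃ β : ℤ, (β + 2 * w) % 4 = 0 ∧ Good β w := by
        rcases Nat.mod_two_eq_zero_or_one w with h | h
        · obtain ⟨β, hβ, hg⟩ := (ih w (by omega) hw).1
          exact ⟨β, by omega, hg⟩
        · obtain ⟨β, hβ, hg⟩ := (ih w (by omega) hw).2 h
          exact ⟨β, by omega, hg⟩
      exact ⟨8 * β, 8 * β - 2, by omega, by omega, by exact_mod_cast (good_five_add_eight_mul hg hβ).1,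
        by exact_mod_cast (good_five_add_eight_mul hg hβ).2⟩
  · obtain ⟨h, h'⟩ := good_of_mod_sixteen_eq_three (M := M) (by omega)
    exact ⟨_, _, by omega, by omega, h, h'⟩
  · obtain ⟨h, h'⟩ := good_of_mod_sixteen_eq_seven (M := M) (by omega)
    exact ⟨_, _, by omega, by omega, h, h'⟩
  · obtain ⟨h, h'⟩ := good_of_mod_sixteen_eq_fifteen (M := M) (by omega)
    exact ⟨_, _, by omega, by omega, h, h'⟩
  · obtain ⟨w, rfl⟩ : ∃ w, M = 11 + 32 * w := ⟨M / 32, by omega⟩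
    rcases Nat.eq_zero_or_pos w with rfl | hw
    · exact ⟨(44 : ℕ), (46 : ℕ), by norm_num, by norm_num, good_of_res (by decide) (by decide)
        (by decide), good_of_res (by decide) (by decide) (by decide)⟩
    · obtain ⟨β, hβ, hg⟩ := (ih w (by omega) hw).1
      exact ⟨32 * β - 20, 32 * β - 18, by omega, by omega, by exact_mod_cast (good_eleven_add hg (by omega)).1,
        by exact_mod_cast (good_eleven_add hg (by omega)).2⟩
  · obtain ⟨w, rfl⟩ : ∃ w, M = 27 + 32 * w := ⟨M / 32, by omega⟩
    rcases Nat.eq_zero_or_pos w with rfl | hw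
    · exact ⟨(92 : ℕ), (94 : ℕ), by norm_num, by norm_num, good_of_res (by decide) (by decide)
        (by decide), good_of_res (by decide) (by decide) (by decide)⟩
    · obtain ⟨β, hβ, hg⟩ := (ih w (by omega) hw).1
      exact ⟨32 * β - 36, 32 * β - 34, by omega, by omega, by exact_mod_cast (good_twentySeven_add hg hβ).1,
        by exact_mod_cast (good_twentySeven_add hg hβ).2⟩

/-! ### Obstructed odd parts and existence of unbordered factors -/

/-- The odd numbers `m` for which every factor of length `1 + 2 ^ k * m`, `k ≥ 3`, is bordered. -/
def Obstructed (m : ℕ) : Prop :=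
  m % 8 = 1 ∧ 1 < m ∨ m % 16 = 5 ∧ 5 < m

/-- The numbers whose odd part is obstructed. -/
def OddPartObstructed (v : ℕ) : Prop :=
  ∃ i m, v = 2 ^ i * m ∧ Obstructed m

/-- An arithmetical description of the lengths without unbordered factors. -/
def AllBordered (n : ℕ) : Prop :=
  n % 16 = 2 ∧ 2 < n ∨ n % 8 = 1 ∧ OddPartObstructed (n / 8) ∨
    n % 64 = 25 ∧ OddPartObstructed (n / 64) ∨ n % 256 = 57 ∧ OddPartObstructed (n / 256)

theorem exists_noMatch_of_not_obstructed {m : ℕ} (hm : m % 2 = 1) (h : ¬Obstructed m) :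
    ∃ b : ℤ, fold b = 1 ∧ fold (b + 2 * m) = -1 ∧ NoMatch b m ∧ (b % 2 = 0 ∨ m % 4 = 3) := by
  unfold Obstructed at h
  obtain rfl | rfl | h3 | h13 : m = 1 ∨ m = 5 ∨ m % 4 = 3 ∨ m % 16 = 13 := by omega
  · exact ⟨4, fold_eq_of_res 3 4 (by norm_num) (by decide) (by decide),
      fold_eq_of_res 3 6 (by norm_num) (by decide) (by decide),
      fun u h1 h2 => by push_cast at h2; omega, by norm_num⟩
  · refine ⟨4, fold_eq_of_res 3 4 (by norm_num) (by decide) (by decide),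
      fold_eq_of_res 3 14 (by norm_num) (by decide) (by decide), fun u h1 h2 => ?_, by norm_num⟩
    push_cast at h2
    rcases (by omega : u = 1 ∨ u = 2) with rfl | rfl
    · exact mis_of_res (j := 10) (k := 10) (a₀ := 4) (d₀ := 8) (l := 3) (by norm_num)
        (by norm_num) (by norm_num) (by decide)
    · exact mis_of_odd (k := 0) (o := 3) (by norm_num) (by norm_num) (by norm_num)
  · exact ⟨-(m + 0), fold_of_mod_one (by omega), fold_of_mod_three (by omega),
      noMatch_center rfl (by norm_num) (by norm_num), Or.inr h3⟩
  · exact ⟨-(m + 1), fold_eq_of_res 3 2 (by norm_num; omega) (by decide) (by decide),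
      fold_eq_of_res 3 12 (by norm_num; omega) (by decide) (by decide),
      noMatch_center rfl (by norm_num) (by norm_num), Or.inl (by omega)⟩

theorem hasUnborderedFactor_of_res {n : ℕ} (a : ℕ)
    (h : ∀ l < n / 2, ∃ i < l + 1,
      res 10 ((a : ℤ) + (i : ℕ)) * res 10 ((a : ℤ) + (n - ((l : ℕ) + 1)) + (i : ℕ)) = -1) :
    HasUnborderedFactor paperfolding n := by
  refine hasUnborderedFactor_of_mis a fun l h0 h2 => ?_
  obtain ⟨m, rfl⟩ : ∃ m : ℕ, l = m + 1 := ⟨(l - 1).toNat, by omega⟩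
  exact mis_of_res (j := 10) (k := 10) (by simp) (by simp) (by push_cast; omega) (h m (by omega))

theorem hasUnborderedFactor_of_not_obstructed {n R K v i m j : ℕ} (hn : n = R + 2 ^ (K + 1) * v)
    (hv : v = 2 ^ i * m) (hm : m % 2 = 1) (h : ¬Obstructed m)
    (hR : 0 < R) (hK : j < K ∨ j = K ∧ (0 < i ∨ m % 4 ≠ 3))
    (table : ∀ l < max R 6, ∃ i < l + 1,
      val 1 j (0 + (i : ℕ)) * val (-1) j (0 + R - ((l : ℕ) + 1) + i) = -1) :
    HasUnborderedFactor paperfolding n := by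
  obtain ⟨b, hb, hb', hbM, hpar⟩ := exists_noMatch_of_not_obstructed hm h
  have hdvd : ∀ c : ℤ, (c % 2 = 0 ∨ m % 4 = 3) → (2 : ℤ) ^ (j + 1) ∣ 2 ^ (K + i) * c := by
    intro c hc
    rcases (by omega : j + 1 ≤ K + i ∨ j = K ∧ i = 0 ∧ m % 4 ≠ 3) with h1 | ⟨h1, h2, h3⟩
    · exact (pow_dvd_pow 2 h1).mul_right c
    · rw [h1, h2, pow_succ]
      exact mul_dvd_mul_left _ (Int.dvd_of_emod_eq_zero (hc.resolve_right h3))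
  refine hasUnborderedFactor_of_noMatch (R := R) (K := K + i) (M := m) (t := 0) ?_ hb hb' hbM
    le_rfl (by omega) (hdvd b hpar) (hdvd _ (by omega)) table
  rw [hn, hv]; push_cast; ring

/-- The start `b` of a good window is divisible by 4 and its end is even, which gives the precisions
`K + 1` and `K` for the two signs. When `n = R` there is no window, and `a` starts an explicit
unbordered factor. -/
theorem hasUnborderedFactor_of_good {n R K j k : ℕ} (t : ℤ) (a : ℕ)
    (hn : n % 2 ^ (K + 1) = R % 2 ^ (K + 1)) (hRn : R ≤ n) (ht : t ≤ 0)
    (ht' : 0 < t + R) (hj : j ≤ K + 1) (hk : k ≤ K)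
    (table : ∀ l < max R 6, ∃ i < l + 1,
      val (-1) j (t + (i : ℕ)) * val 1 k (t + R - ((l : ℕ) + 1) + i) = -1)
    (small : ∀ l < R / 2, ∃ i < l + 1,
      res 10 ((a : ℤ) + (i : ℕ)) * res 10 ((a : ℤ) + (R - ((l : ℕ) + 1)) + (i : ℕ)) = -1) :
    HasUnborderedFactor paperfolding n := by
  obtain ⟨M, hM⟩ := (Nat.modEq_iff_dvd' hRn).1 (Eq.symm hn)
  rcases Nat.eq_zero_or_pos M with rfl | hM0
  · obtain rfl : n = R := by omega
    exact hasUnborderedFactor_of_res a small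
  obtain ⟨b, hb4, hb, hb', hbM⟩ := (exists_good M hM0).1
  refine hasUnborderedFactor_of_noMatch (R := R) (K := K) (M := M) (t := t) (j := j) (k := k) ?_
    hb (by rw [hb', neg_neg]) hbM ht ht' ?_ ?_ (by simpa using table)
  · have : n = R + 2 ^ (K + 1) * M := by omega
    rw [this]; push_cast; ring
  · obtain ⟨c, rfl⟩ : (4 : ℤ) ∣ b := Int.dvd_of_emod_eq_zero hb4
    rw [show (2 : ℤ) ^ K * (4 * c) = 2 ^ (K + 2) * c by ring]
    exact (pow_dvd_pow 2 (by omega)).mul_right c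
  · obtain ⟨c, hc⟩ : (2 : ℤ) ∣ b + 2 * M := by omega
    rw [hc, show (2 : ℤ) ^ K * (2 * c) = 2 ^ (K + 1) * c by ring]
    exact (pow_dvd_pow 2 (by omega)).mul_right c

theorem hasUnborderedFactor_of_mod_eight_ne_one {n : ℕ} (h8 : n % 8 ≠ 1) (h16 : n % 16 ≠ 2) :
    HasUnborderedFactor paperfolding n := by
  rcases Nat.eq_zero_or_pos n with rfl | hn
  · exact hasUnborderedFactor_of_res 1 (by decide)
  obtain h | h | h | h | h | h | h | h | h | h | h | h | h : n % 16 = 3 ∨ n % 16 = 4 ∨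
      n % 16 = 5 ∨ n % 16 = 6 ∨ n % 16 = 7 ∨ n % 16 = 8 ∨ n % 16 = 10 ∨ n % 16 = 11 ∨
      n % 16 = 12 ∨ n % 16 = 13 ∨ n % 16 = 14 ∨ n % 16 = 15 ∨ n % 16 = 16 % 16 := by omega
  · exact hasUnborderedFactor_of_good (R := 3) (K := 3) (j := 4) (k := 3) 0 1 h (by omega)
      (by decide) (by decide) (by decide) (by decide) (by decide) (by decide)
  · exact hasUnborderedFactor_of_good (R := 4) (K := 3) (j := 4) (k := 3) (-1) 4 h (by omega)
      (by decide) (by decide) (by decide) (by decide) (by decide) (by decide)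
  · exact hasUnborderedFactor_of_good (R := 5) (K := 3) (j := 4) (k := 3) (-2) 6 h (by omega)
      (by decide) (by decide) (by decide) (by decide) (by decide) (by decide)
  · exact hasUnborderedFactor_of_good (R := 6) (K := 3) (j := 4) (k := 3) (-1) 2 h (by omega)
      (by decide) (by decide) (by decide) (by decide) (by decide) (by decide)
  · exact hasUnborderedFactor_of_good (R := 7) (K := 3) (j := 4) (k := 3) (-1) 1 h (by omega)
      (by decide) (by decide) (by decide) (by decide) (by decide) (by decide)
  · exact hasUnborderedFactor_of_good (R := 8) (K := 3) (j := 4) (k := 3) (-2) 3 h (by omega)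
      (by decide) (by decide) (by decide) (by decide) (by decide) (by decide)
  · exact hasUnborderedFactor_of_good (R := 10) (K := 3) (j := 4) (k := 3) (-4) 11 h (by omega)
      (by decide) (by decide) (by decide) (by decide) (by decide) (by decide)
  · exact hasUnborderedFactor_of_good (R := 11) (K := 3) (j := 4) (k := 3) (-5) 2 h (by omega)
      (by decide) (by decide) (by decide) (by decide) (by decide) (by decide)
  · exact hasUnborderedFactor_of_good (R := 12) (K := 3) (j := 4) (k := 3) (-9) 1 h (by omega)
      (by decide) (by decide) (by decide) (by decide) (by decide) (by decide)
  · exact hasUnborderedFactor_of_good (R := 13) (K := 3) (j := 4) (k := 3) (-10) 16 h (by omega)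
      (by decide) (by decide) (by decide) (by decide) (by decide) (by decide)
  · exact hasUnborderedFactor_of_good (R := 14) (K := 3) (j := 4) (k := 3) (-9) 1 h (by omega)
      (by decide) (by decide) (by decide) (by decide) (by decide) (by decide)
  · exact hasUnborderedFactor_of_good (R := 15) (K := 3) (j := 4) (k := 3) (-4) 1 h (by omega)
      (by decide) (by decide) (by decide) (by decide) (by decide) (by decide)
  · exact hasUnborderedFactor_of_good (R := 16) (K := 3) (j := 4) (k := 3) (-2) 3 h (by omega)
      (by decide) (by decide) (by decide) (by decide) (by decide) (by decide)

theorem exists_not_obstructed {v : ℕ} (hv : 0 < v) (h : ¬OddPartObstructed v) :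
    ∃ i m, v = 2 ^ i * m ∧ m % 2 = 1 ∧ ¬Obstructed m := by
  obtain ⟨i, m, hm, hi⟩ := Nat.exists_eq_two_pow_mul_odd hv.ne'
  exact ⟨i, m, hi, Nat.odd_iff.1 hm, fun h' => h ⟨i, m, hi, h'⟩⟩

set_option maxRecDepth 10000 in
theorem hasUnborderedFactor_of_mod_eight_eq_one {n : ℕ} (h8 : n % 8 = 1) (h : ¬AllBordered n) :
    HasUnborderedFactor paperfolding n := by
  simp only [AllBordered, not_or, not_and] at h
  obtain ⟨-, hA, hB, hC⟩ := h
  rcases Nat.eq_zero_or_pos (n / 8) with h0 | h0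
  · obtain rfl : n = 1 := by omega
    exact hasUnborderedFactor_of_res 1 (by decide)
  obtain ⟨i, m, hv, hm, hob⟩ := exists_not_obstructed h0 (hA h8)
  -- If `i = 0` and `m % 4 = 3`, the available `b` may be odd, and `4 * b` is then not divisible by
  -- 8 as the table requires.
  by_cases hex : 0 < i ∨ m % 4 ≠ 3
  · exact hasUnborderedFactor_of_not_obstructed (R := 1) (K := 2) (j := 2) (by omega) hv hm hob
      (by decide) (Or.inr ⟨rfl, hex⟩) (by decide)
  obtain ⟨rfl, h3⟩ : i = 0 ∧ m % 4 = 3 := by omega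
  rw [pow_zero, one_mul] at hv
  -- Now `n % 32 = 25`, and a longer remainder `R` is split off. For 25 and 57 the signs `1, -1` are
  -- used again; for 121 and 185 the pattern `-1, 1` works, so no obstruction arises.
  obtain h | h | h | h : n % 64 = 25 ∨ n % 256 = 57 ∨ n % 128 = 121 ∨ n % 256 = 185 := by omega
  · rcases Nat.eq_zero_or_pos (n / 64) with h0 | h0
    · obtain rfl : n = 25 := by omega
      exact hasUnborderedFactor_of_res 32 (by decide)
    · obtain ⟨i, m, hv, hm, hob⟩ := exists_not_obstructed h0 (hB h)
      exact hasUnborderedFactor_of_not_obstructed (R := 25) (K := 5) (j := 4) (by omega) hv hm hob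
        (by decide) (Or.inl (by decide)) (by decide)
  · rcases Nat.eq_zero_or_pos (n / 256) with h0 | h0
    · obtain rfl : n = 57 := by omega
      exact hasUnborderedFactor_of_res 32 (by decide)
    · obtain ⟨i, m, hv, hm, hob⟩ := exists_not_obstructed h0 (hC h)
      exact hasUnborderedFactor_of_not_obstructed (R := 57) (K := 7) (j := 6) (by omega) hv hm hob
        (by decide) (Or.inl (by decide)) (by decide)
  · exact hasUnborderedFactor_of_good (R := 121) (K := 6) (j := 6) (k := 6) (-24) 32 h (by omega)
      (by decide) (by decide) (by decide) (by decide) (by decide) (by decide)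
  · exact hasUnborderedFactor_of_good (R := 185) (K := 7) (j := 7) (k := 7) (-88) 8 h (by omega)
      (by decide) (by decide) (by decide) (by decide) (by decide) (by decide)

theorem hasUnborderedFactor_of_not_allBordered {n : ℕ} (h : ¬AllBordered n) :
    HasUnborderedFactor paperfolding n := by
  by_cases h8 : n % 8 = 1
  · exact hasUnborderedFactor_of_mod_eight_eq_one h8 h
  by_cases h16 : n % 16 = 2
  · obtain rfl : n = 2 := by
      have : ¬(n % 16 = 2 ∧ 2 < n) := fun h' => h (Or.inl h')
      omega
    exact hasUnborderedFactor_of_res 2 (by decide)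
  · exact hasUnborderedFactor_of_mod_eight_ne_one h8 h16

/-! ### Lengths all of whose factors are bordered -/

/-- A mismatch under a shift by a multiple of `2 ^ (k + 1)` occurs at a multiple of `2 ^ k`. -/
theorem Mis.exists_dvd {a d l : ℤ} (h : Mis a d l) {k : ℕ} (hd : (2 : ℤ) ^ (k + 1) ∣ d) :
    ∃ x, a ≤ x ∧ x < a + l ∧ (2 : ℤ) ^ k ∣ x ∧ fold x ≠ fold (x + d) := by
  obtain ⟨x, hx, hx', hne⟩ := h
  refine ⟨x, hx, hx', ?_, hne⟩
  by_contra hk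
  exact hne (fold_congr (by simpa using hd) hk).symm

theorem eq_neg_of_fold_ne {x y : ℤ} (h : fold x ≠ fold y) : fold x = -fold y := by
  rcases fold_eq_one_or x with h1 | h1 <;> rcases fold_eq_one_or y with h2 | h2 <;>
    simp_all

section Bordered

variable {n : ℕ} {a : ℤ}

/-- Excluding border 2 puts a multiple of 8 at `a` or `a + 1`. Excluding border 1 then fixes the
remaining signs, and these make the two windows of length 3 equal. -/
theorem false_of_mod_sixteen_eq_two (h : ∀ l : ℤ, 0 < l → 2 * l ≤ n → Mis a (n - l) l)
    (hn : n % 16 = 2) (hn2 : 2 < n) : False := by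
  obtain ⟨x, hx, hx', hdvd, hne⟩ := (h 2 (by norm_num) (by omega)).exists_dvd (k := 3)
    (by norm_num; omega)
  norm_num at hdvd
  obtain ⟨z, hz, hz', hz1⟩ := h 1 (by norm_num) (by omega)
  obtain rfl : z = a := by omega
  obtain ⟨y, hy, hy', hy3⟩ := h 3 (by norm_num) (by omega)
  rw [show z + ((n : ℤ) - 1) = z + n - 1 by ring] at hz1
  rcases (by omega : x = z ∨ x = z + 1) with rfl | rfl
  · have h1 : fold (x + n - 1) = 1 := fold_of_mod_one (by omega)
    have h2 := eq_neg_of_fold_ne hz1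
    have h3 := eq_neg_of_fold_ne hne.symm
    rw [h1] at h2
    rw [h2, neg_neg] at h3
    refine hy3 ?_
    rcases (by omega : y = x ∨ y = x + 1 ∨ y = x + 2) with rfl | rfl | rfl
    · rw [h2, fold_of_mod_three (by omega)]
    · rw [show x + 1 + ((n : ℤ) - 3) = x + (n - 2) by ring, h3, fold_of_mod_one (by omega)]
    · rw [show x + 2 + ((n : ℤ) - 3) = x + n - 1 by ring, h1]
      exact fold_eq_of_res 2 2 (by norm_num; omega) (by decide) (by decide)
  · have h1 : fold z = -1 := fold_of_mod_three (by omega)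
    have h2 := eq_neg_of_fold_ne hz1.symm
    have h3 := eq_neg_of_fold_ne hne
    rw [h1, neg_neg] at h2
    rw [show z + 1 + ((n : ℤ) - 2) = z + n - 1 by ring, h2] at h3
    refine hy3 ?_
    rcases (by omega : y = z ∨ y = z + 1 ∨ y = z + 2) with rfl | rfl | rfl
    · rw [h1]
      exact (fold_eq_of_res 2 6 (by norm_num; omega) (by decide) (by decide)).symm
    · rw [h3, fold_of_mod_three (by omega)]
    · rw [show z + 2 + ((n : ℤ) - 3) = z + n - 1 by ring, h2, fold_of_mod_one (by omega)]

/-- Border 1 gives `4 ∣ a` and opposite end signs, border 2 decides which sign is where, and border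
4 excludes `a % 8 = 4`. -/
theorem ends_of_mod_eight_eq_one (h : ∀ l : ℤ, 0 < l → 2 * l ≤ n → Mis a (n - l) l)
    (hn : n % 8 = 1) (hn8 : 8 < n) : a % 8 = 0 ∧ fold a = 1 ∧ fold (a + (n - 1)) = -1 := by
  obtain ⟨x, hx, hx', hdvd, hne⟩ := (h 1 (by norm_num) (by omega)).exists_dvd (k := 2)
    (by norm_num; omega)
  norm_num at hdvd
  obtain rfl : x = a := by omega
  have h1 : fold x = 1 := by
    obtain ⟨y, hy, hy', hy2⟩ := h 2 (by norm_num) (by omega)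
    rcases (by omega : y = x ∨ y = x + 1) with rfl | rfl
    · rw [fold_of_mod_three (x := y + ((n : ℤ) - 2)) (by omega)] at hy2
      exact (fold_eq_one_or y).resolve_right hy2
    · rw [fold_of_mod_one (x := x + 1) (by omega),
        show x + 1 + ((n : ℤ) - 2) = x + (n - 1) by ring] at hy2
      have := eq_neg_of_fold_ne hne
      rwa [(fold_eq_one_or _).resolve_left (Ne.symm hy2), neg_neg] at this
  have h2 : fold (x + (n - 1)) = -1 := by rw [eq_neg_of_fold_ne hne.symm, h1]
  refine ⟨?_, h1, h2⟩
  by_contra h8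
  obtain ⟨y, hy, hy', hy4⟩ := h 4 (by norm_num) (by omega)
  refine hy4 ?_
  rcases (by omega : y = x ∨ y = x + 1 ∨ y = x + 2 ∨ y = x + 3) with rfl | rfl | rfl | rfl
  · rw [h1, fold_of_mod_one (by omega)]
  · rw [fold_of_mod_one (x := x + 1) (by omega)]
    exact (fold_eq_of_res 2 2 (by norm_num; omega) (by decide) (by decide)).symm
  · rw [fold_of_mod_three (x := x + 2 + ((n : ℤ) - 4)) (by omega)]
    exact fold_eq_of_res 2 6 (by norm_num; omega) (by decide) (by decide)
  · rw [show x + 3 + ((n : ℤ) - 4) = x + (n - 1) by ring, h2, fold_of_mod_three (by omega)]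

/-- Borders of length `R + 2 ^ (K + 1) * e` have shift `2 ^ (K + 1) * (m - e)`. With `e = 1` or `e =
5` the factor `m - e` is highly even, so the mismatch lies at a very divisible point near `2 ^ K *
c`; this pins `c` to residues whose signs contradict `hc` or `hc'`. -/
theorem false_of_obstructed {R K m : ℕ} {c : ℤ}
    (h : ∀ l : ℤ, 0 < l → 2 * l ≤ n → Mis a (n - l) l) (hn : n = R + 2 ^ (K + 1) * m)
    (hm : Obstructed m) (hR : 0 < R) (hRK : R ≤ 2 ^ K) (hc : fold c = 1)
    (hc' : fold (c + 2 * m) = -1) (ha : a ≤ 2 ^ K * c) (ha' : 2 ^ K * c < a + R) : False := by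
  have hK : (0 : ℤ) < 2 ^ K := by positivity
  have hRK' : (R : ℤ) ≤ 2 ^ K := by exact_mod_cast hRK
  have key : ∀ (e : ℤ) (j : ℕ), 0 < e → 2 * e < m → (2 : ℤ) ^ j ∣ m - e →
      ∃ y, c ≤ y ∧ y ≤ c + 2 * e ∧ (2 : ℤ) ^ j ∣ y := by
    intro e j he hem ⟨f, hf⟩
    have hd : (n : ℤ) - (R + 2 ^ (K + 1) * e) = 2 ^ (K + j + 1) * f := by
      rw [hn]; push_cast
      linear_combination (2 : ℤ) ^ (K + 1) * hf
    have h2 : (2 : ℤ) ^ (K + 1) = 2 * 2 ^ K := pow_succ' 2 K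
    have hpos : (0 : ℤ) < 2 ^ (K + 1) * e := by positivity
    have hle : (2 : ℤ) ^ (K + 1) * (2 * e + 1) ≤ 2 ^ (K + 1) * m := by gcongr; omega
    have hn' : (n : ℤ) = R + 2 ^ (K + 1) * m := by rw [hn]; push_cast; ring
    obtain ⟨x, hx, hx', ⟨g, hg⟩, -⟩ := (h (R + 2 ^ (K + 1) * e) (by omega)
      (by rw [hn']; linarith)).exists_dvd (k := K + j) ⟨f, hd⟩
    have hxy : x = 2 ^ K * (2 ^ j * g) := by rw [hg]; ring
    refine ⟨2 ^ j * g, ?_, ?_, dvd_mul_right _ _⟩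
    · have : (2 : ℤ) ^ K * (c - 1) < 2 ^ K * (2 ^ j * g) := by rw [← hxy]; linarith
      have := lt_of_mul_lt_mul_left this hK.le
      omega
    · have : (2 : ℤ) ^ K * (2 ^ j * g) < 2 ^ K * (c + 2 * e + 1) := by
        rw [← hxy]
        have : (2 : ℤ) ^ (K + 1) * e = 2 ^ K * (2 * e) := by rw [h2]; ring
        linarith
      have := lt_of_mul_lt_mul_left this hK.le
      omega
  have hs : ∀ {x : ℤ} (k : ℕ) (y s : ℤ), fold x = -s → (2 : ℤ) ^ (k + 1) ∣ x - y →
      res k y = s → s ≠ 0 → False := by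
    intro x k y s h1 h2 h3 h4
    rw [fold_eq_of_res k y h2 h3 h4] at h1
    omega
  rcases hm with ⟨h1, h2⟩ | ⟨h1, h2⟩
  · obtain ⟨y, hy, hy', hdvd⟩ := key 1 3 (by norm_num) (by omega) (by norm_num; omega)
    norm_num at hdvd
    rcases (by omega : c = y ∨ c = y - 1 ∨ c = y - 2) with rfl | rfl | rfl
    · exact hs 2 2 1 hc' (by norm_num; omega) (by decide) (by decide)
    · exact hs 2 (-1) (-1) hc (by norm_num; omega) (by decide) (by decide)
    · exact hs 2 (-2) (-1) hc (by norm_num; omega) (by decide) (by decide)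
  · obtain ⟨z, hz, hz', hdvd'⟩ := key 1 2 (by norm_num) (by omega) (by norm_num; omega)
    norm_num at hdvd'
    obtain ⟨y, hy, hy', hdvd⟩ := key 5 4 (by norm_num) (by omega) (by norm_num; omega)
    norm_num at hdvd
    -- Here `c = y - i` with `16 ∣ y`, and `c + 2 * m` is `10 - i` mod 16. The undecided case `i % 4
    -- = 3` means `c % 4 = 1`, impossible since `[c, c + 2]` contains the multiple `z` of 4.
    have hfin : ∀ i < 11, res 3 (-(i : ℕ)) = -1 ∨ res 3 (-(i : ℕ) + 10) = 1 ∨ i % 4 = 3 := by decide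
    obtain ⟨i, hi⟩ : ∃ i : ℕ, (i : ℤ) = y - c := ⟨(y - c).toNat, by omega⟩
    rcases hfin i (by omega) with h3 | h3 | h3
    · exact hs 3 (-i) (-1) hc (by norm_num; omega) h3 (by decide)
    · exact hs 3 (-i + 10) 1 hc' (by norm_num; omega) h3 (by decide)
    · omega

theorem false_of_oddPartObstructed (h : ∀ l : ℤ, 0 < l → 2 * l ≤ n → Mis a (n - l) l)
    (hn : n % 8 = 1) (hT : OddPartObstructed (n / 8)) : False := by
  obtain ⟨i, m, hv, hm⟩ := hT
  have hn' : n = 1 + 2 ^ (2 + i + 1) * m := by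
    have : 2 ^ (2 + i + 1) * m = 8 * (n / 8) := by rw [hv]; ring
    omega
  have hm1 : 1 < m := by unfold Obstructed at hm; omega
  have hn8 : 8 < n := by
    have : 2 ^ 3 * m ≤ 2 ^ (2 + i + 1) * m := by gcongr <;> omega
    omega
  obtain ⟨-, h1, h2⟩ := ends_of_mod_eight_eq_one h hn hn8
  have hd : (n : ℤ) - 1 = 2 ^ (2 + i + 1) * m := by rw [hn']; push_cast; ring
  obtain ⟨x, hx, hx', ⟨c, hc⟩, -⟩ := (h 1 (by norm_num) (by omega)).exists_dvd (k := 2 + i)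
    ⟨m, hd⟩
  obtain rfl : x = a := by omega
  refine false_of_obstructed (c := c) h hn' hm one_pos Nat.one_le_two_pow ?_ ?_ hc.le (by omega)
  · rwa [hc, fold_pow_mul] at h1
  · rwa [hd, hc, show (2 : ℤ) ^ (2 + i) * c + 2 ^ (2 + i + 1) * m = 2 ^ (2 + i) * (c + 2 * m) by
      ring, fold_pow_mul] at h2

/-- Border `R` yields a multiple `x` of `2 ^ (K + i)` among the first `R` positions. If `x` is first
or last there, the signs at the ends of the factor pass to `c`; `hres` says that any other position
contradicts those end signs. -/
theorem false_of_oddPartObstructed_of_lt {R K : ℕ}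
    (h : ∀ l : ℤ, 0 < l → 2 * l ≤ n → Mis a (n - l) l)
    (hRK : R ≤ 2 ^ K) (hK : 3 ≤ K) (hR8 : R % 8 = 1)
    (hn : n % 2 ^ (K + 1) = R) (hT : OddPartObstructed (n / 2 ^ (K + 1)))
    (hres : ∀ i < R, i % 8 = 0 → i ≠ 0 → i + 1 ≠ R →
      res (K - 1) (-(i : ℕ)) = -1 ∨ res (K - 1) (-(i : ℕ) + R - 1) = 1) : False := by
  obtain ⟨i, m, hv, hm⟩ := hT
  have hsplit : n = R + 2 ^ (K + 1) * (n / 2 ^ (K + 1)) := by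
    have := Nat.mod_add_div n (2 ^ (K + 1)); omega
  have hn' : n = R + 2 ^ (K + i + 1) * m := by
    rw [hsplit, hv]; ring
  have hm1 : 1 < m := by unfold Obstructed at hm; omega
  have hKi : 2 ^ K ≤ 2 ^ (K + i) := Nat.pow_le_pow_right (by norm_num) (by omega)
  have hnR : 2 * R ≤ n := by
    have h1 : 2 ^ (K + i + 1) * 1 ≤ 2 ^ (K + i + 1) * m := by gcongr
    have h2 : 2 ^ (K + i + 1) = 2 * 2 ^ (K + i) := pow_succ' 2 _
    omega
  have h8 : 8 ≤ 2 ^ K := Nat.pow_le_pow_right (n := 2) (by norm_num) hK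
  have hdvd8 : 8 ∣ 2 ^ (K + i + 1) * m :=
    ((pow_dvd_pow 2 (by omega : 3 ≤ K + i + 1)).mul_right m)
  have hn8 : 8 < n := by
    have h1 : 2 ^ (K + i + 1) * 2 ≤ 2 ^ (K + i + 1) * m := by gcongr; omega
    have h2 : 2 ^ (K + i + 1) = 2 * 2 ^ (K + i) := pow_succ' 2 _
    omega
  obtain ⟨ha8, h1, h2⟩ := ends_of_mod_eight_eq_one h (by omega) hn8
  have hd : (n : ℤ) - R = 2 ^ (K + i + 1) * m := by rw [hn']; push_cast; ring
  obtain ⟨x, hx, hx', ⟨c, hc⟩, hne⟩ := (h R (by omega) (by omega)).exists_dvd (k := K + i)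
    ⟨m, hd⟩
  have hx2 : x + (n - R) = 2 ^ (K + i) * (c + 2 * m) := by rw [hc, hd]; ring
  rw [hx2, hc, fold_pow_mul, fold_pow_mul] at hne
  have hxK : (2 : ℤ) ^ (K - 1 + 1) ∣ x := by
    rw [hc, Nat.sub_add_cancel (by omega)]
    exact (pow_dvd_pow 2 (by omega)).mul_right c
  obtain ⟨s, hs⟩ : ∃ s : ℕ, (s : ℤ) = x - a := ⟨(x - a).toNat, by omega⟩
  suffices hfin : fold c = 1 by
    refine false_of_obstructed (c := c) h hn' hm (by omega) (by omega) hfin ?_ (by omega)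
      (by omega)
    rw [eq_neg_of_fold_ne hne.symm, hfin]
  by_cases hs0 : s = 0
  · rw [← fold_pow_mul (K + i) c, ← hc, show x = a by omega, h1]
  by_cases hsR : s + 1 = R
  · have h3 : a + (n - 1) = x + (n - R) := by omega
    rw [h3, hx2, fold_pow_mul] at h2
    rw [eq_neg_of_fold_ne hne, h2, neg_neg]
  exfalso
  have hs8 : s % 8 = 0 := by
    have : (8 : ℤ) ∣ x := by
      rw [hc]
      exact (pow_dvd_pow 2 (by omega : 3 ≤ K + i)).mul_right c
    omega
  rcases hres s (by omega) hs8 hs0 hsR with h3 | h3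
  · rw [fold_eq_of_res (K - 1) (-s) (by rwa [show a - -(s : ℤ) = x by omega]) h3 (by norm_num)]
      at h1
    norm_num at h1
  · rw [fold_eq_of_res (K - 1) (-s + R - 1) ?_ h3 (by norm_num)] at h2
    · norm_num at h2
    · have h5 : a + (n - 1) - (-(s : ℤ) + R - 1) = x + 2 ^ (K + i + 1) * m := by
        rw [← hd]; omega
      rw [h5]
      refine dvd_add hxK ?_
      exact (pow_dvd_pow 2 (by omega)).mul_right _

end Bordered

theorem not_hasUnborderedFactor_of_allBordered {n : ℕ} (h : AllBordered n) :
    ¬HasUnborderedFactor paperfolding n := by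
  rintro ⟨j, hj⟩
  rw [not_isBordered_iff_mis] at hj
  rcases h with ⟨h, h'⟩ | ⟨h, h'⟩ | ⟨h, h'⟩ | ⟨h, h'⟩
  · exact false_of_mod_sixteen_eq_two hj h h'
  · exact false_of_oddPartObstructed hj h h'
  · exact false_of_oddPartObstructed_of_lt (R := 25) (K := 5) hj (by decide) (by decide)
      (by decide) h h' (by decide)
  · exact false_of_oddPartObstructed_of_lt (R := 57) (K := 7) hj (by decide) (by decide)
      (by decide) h h' (by decide)

/-! ### The automaton computes the arithmetical description -/

theorem oddPartObstructed_two_mul (v : ℕ) : OddPartObstructed (2 * v) ↔ OddPartObstructed v := by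
  constructor
  · rintro ⟨i, m, h, hm⟩
    cases i with
    | zero => unfold Obstructed at hm; omega
    | succ i => exact ⟨i, m, by rw [pow_succ', mul_assoc] at h; omega, hm⟩
  · rintro ⟨i, m, rfl, hm⟩
    exact ⟨i + 1, m, by ring, hm⟩

theorem oddPartObstructed_two_mul_add_one (v : ℕ) :
    OddPartObstructed (2 * v + 1) ↔ Obstructed (2 * v + 1) := by
  constructor
  · rintro ⟨i, m, h, hm⟩
    cases i with
    | zero => rw [h, pow_zero, one_mul]; exact hm
    | succ i => rw [pow_succ', mul_assoc] at h; omega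
  · exact fun h => ⟨0, _, by simp, h⟩

theorem not_oddPartObstructed_zero : ¬OddPartObstructed 0 := by
  rintro ⟨i, m, h, hm⟩
  have : m = 0 := by simpa using h.symm
  unfold Obstructed at hm
  omega

/-- The numbers accepted by `automaton` when it is started in the given state. -/
def AcceptedFrom : Fin 17 → ℕ → Prop :=
  ![fun v => AllBordered v,
    fun v => v % 8 = 1 ∧ 1 < v,
    fun v => v % 4 = 0 ∧ OddPartObstructed (v / 4) ∨ v % 32 = 12 ∧ OddPartObstructed (v / 32) ∨
      v % 128 = 28 ∧ OddPartObstructed (v / 128),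
    fun _ => False,
    fun v => v % 4 = 0 ∧ 0 < v,
    fun v => v % 2 = 0 ∧ OddPartObstructed (v / 2) ∨ v % 16 = 6 ∧ OddPartObstructed (v / 16) ∨
      v % 64 = 14 ∧ OddPartObstructed (v / 64),
    fun v => v % 2 = 0 ∧ 0 < v,
    fun v => OddPartObstructed v ∨ v % 8 = 3 ∧ OddPartObstructed (v / 8) ∨
      v % 32 = 7 ∧ OddPartObstructed (v / 32),
    fun v => 0 < v,
    fun v => OddPartObstructed v,
    fun v => Obstructed (2 * v + 1) ∨ v % 4 = 1 ∧ OddPartObstructed (v / 4) ∨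
      v % 16 = 3 ∧ OddPartObstructed (v / 16),
    fun _ => True,
    fun v => Obstructed (2 * v + 1),
    fun v => Obstructed (4 * v + 1),
    fun v => v % 2 = 0 ∧ OddPartObstructed (v / 2) ∨ v % 8 = 1 ∧ OddPartObstructed (v / 8),
    fun v => v % 4 = 0 ∧ OddPartObstructed (v / 4),
    fun v => v % 2 = 0 ∧ OddPartObstructed (v / 2)]

theorem acceptedFrom_zero (q : Fin 17) : AcceptedFrom q 0 ↔ q = 11 := by
  have := not_oddPartObstructed_zero
  fin_cases q <;> simp [AcceptedFrom, AllBordered, Obstructed, this]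

theorem acceptedFrom_even (q : Fin 17) (v : ℕ) :
    AcceptedFrom q (2 * v) ↔ AcceptedFrom (transition q 0) v := by
  have h0 := not_oddPartObstructed_zero
  have h2 := oddPartObstructed_two_mul
  have e1 : 2 * v / 4 = v / 2 := by omega
  have e2 : 2 * v / 8 = v / 4 := by omega
  have e3 : 2 * v / 16 = v / 8 := by omega
  have e4 : 2 * v / 32 = v / 16 := by omega
  have e5 : 2 * v / 64 = v / 32 := by omega
  have e6 : 2 * v / 128 = v / 64 := by omega
  have e7 : 2 * v / 2 = v := by omega
  have e8 : 2 * v / 256 = v / 128 := by omega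
  fin_cases q <;>
    simp only [AcceptedFrom, transition, AllBordered, Obstructed, h2, e1, e2, e3, e4, e5, e6, e7,
      e8, Fin.reduceFinMk, Fin.isValue, Matrix.cons_val] <;> grind

theorem acceptedFrom_odd (q : Fin 17) (v : ℕ) :
    AcceptedFrom q (2 * v + 1) ↔ AcceptedFrom (transition q 1) v := by
  have h2 := oddPartObstructed_two_mul_add_one
  have e1 : (2 * v + 1) / 4 = v / 2 := by omega
  have e2 : (2 * v + 1) / 8 = v / 4 := by omega
  have e3 : (2 * v + 1) / 16 = v / 8 := by omega
  have e4 : (2 * v + 1) / 32 = v / 16 := by omega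
  have e5 : (2 * v + 1) / 64 = v / 32 := by omega
  have e6 : (2 * v + 1) / 128 = v / 64 := by omega
  have e7 : (2 * v + 1) / 2 = v := by omega
  have e8 : (2 * v + 1) / 256 = v / 128 := by omega
  fin_cases q <;>
    simp only [AcceptedFrom, transition, AllBordered, Obstructed, h2, e1, e2, e3, e4, e5, e6, e7,
      e8, Fin.reduceFinMk, Fin.isValue, Matrix.cons_val] <;> grind

/-- Reading the least significant digit first replaces `2 * v + d` by `v`, so compatibility of
`AcceptedFrom` with single transitions suffices; its value at 0 makes trailing zeros harmless. -/
theorem evalFrom_eq_iff (w : List (Fin 2)) (q : Fin 17) :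
    automaton.evalFrom q w = 11 ↔ AcceptedFrom q (Nat.ofDigits 2 (w.map Fin.val)) := by
  induction w generalizing q with
  | nil => simp [acceptedFrom_zero]
  | cons d w ih =>
    rw [DFA.evalFrom_cons, ih, List.map_cons, Nat.ofDigits_cons]
    fin_cases d
    · exact (acceptedFrom_even q _).symm.trans (by simp)
    · exact (acceptedFrom_odd q _).symm.trans (by simp [add_comm])

end Paperfolding

theorem theorem6 (n : ℕ) (w : List (Fin 2)) (hw : Paperfolding.IsReversedRep w n) :
    Paperfolding.HasUnborderedFactor Paperfolding.paperfolding n ↔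
      w ∉ Paperfolding.automaton.accepts := by
  have h : w ∈ Paperfolding.automaton.accepts ↔ Paperfolding.AllBordered n := by
    have := Paperfolding.evalFrom_eq_iff w 0
    rw [hw] at this
    exact this
  rw [h]
  exact ⟨fun hu hb => Paperfolding.not_hasUnborderedFactor_of_allBordered hb hu,
    Paperfolding.hasUnborderedFactor_of_not_allBordered⟩
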